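/- Let $G=(V,E)$ be a finite bipartite graph whose edge weights $\tilde c_e$ $(e\in E)$ are independent random variables with values in known integer intervals $\{c_e^-,c_e^-+1,\dots,c_e^+\}$, $0\le c_e^-\le c_e^+$, such that $\Pr(\tilde c_e=c_e^+)\ge p$ for every $e$, where $p\in(0,1]$ is known; apart from this, the distributions are unknown. A query to an edge $e$ reveals the realized value of $\tilde c_e$. A (randomized, adaptive) query algorithm is given $G$, $(c_e^-)_{e\in E}$, $(c_e^+)_{e\in E}$, $p$ and $\varepsilon$. It queries edges one after another, each choice depending on the previously revealed values and on internal randomness that is independent of the weights, and finally returns a matching of $G$. For every $K\in\mathbb{Z}_{\ge 0}$ there is a constant $C=C(K)$ such that, for all such $G$ and $c^-,c^+$ with $c_e^+\le K$ for all $e\in E$, all $p\in(0,1]$ and all $\varepsilon\in(0,1)$, there is such an algorithm with the following two properties. 1. In every execution, at every vertex $v\in V$, it queries at most $$C\cdot\frac{\log\bigl(1/(\varepsilon p)\bigr)}{\varepsilon p}$$ edges incident to $v$ (counted with repetitions). 2. For all weight distributions as above, with probability at least $1-\varepsilon$ (over the weights and the internal randomness) the returned matching $M$ is $(1-\varepsilon)$-approximate,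 that is, $$\sum_{e\in M}\tilde c_e\ \ge\ (1-\varepsilon)\max\Bigl\{\sum_{e\in N}\tilde c_e : N\subseteq E\text{ a matching of }G\Bigr\}.$$ -/

import Mathlib

open MeasureTheory

/-- A deterministic adaptive query algorithm on a finite set `E` of items with hidden weights in
`ℕ`: it either stops and returns a set of items, or queries an item and continues in a way
that may depend on the revealed weight. -/
inductive QueryTree (E : Type*) where
  | output (M : Finset E) : QueryTree E
  | query (e : E) (next : ℕ → QueryTree E) : QueryTree E

namespace QueryTree

/-- The set returned when the realized weights are `c`. -/
def result {E : Type*} : QueryTree E → (E → ℕ) → Finset E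
  | output M, _ => M
  | query e next, c => (next (c e)).result c

open Classical in
/-- The number of queries to items of `S` (counted with repetitions) that are made when the
realized weights are `c`. -/
noncomputable def queryCount {E : Type*} (S : Set E) : QueryTree E → (E → ℕ) → ℕ
  | output _, _ => 0
  | query e next, c => (if e ∈ S then 1 else 0) + (next (c e)).queryCount S c

end QueryTree

namespace StochasticMatching

/-- A set of edges is a matching if every vertex lies on at most one of them. -/
def IsMatching {V : Type*} {G : SimpleGraph V} (M : Finset G.edgeSet) : Prop :=
  ∀ u : V, ∀ e ∈ M, ∀ f ∈ M, u ∈ e.1 → u ∈ f.1 → e = f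

/-- `M` is a matching whose `c`-weight is at least `α` times that of every matching. -/
def IsApproxMaxMatching {V : Type*} {G : SimpleGraph V} (α : ℝ) (c : G.edgeSet → ℕ)
    (M : Finset G.edgeSet) : Prop :=
  IsMatching M ∧
    ∀ N : Finset G.edgeSet, IsMatching N → α * ((∑ e ∈ N, c e : ℕ) : ℝ) ≤ ((∑ e ∈ M, c e : ℕ) : ℝ)

/-- The families of weight distributions compatible with the known data: the weight of `e` lies in
`{lo e, …, hi e}` and equals `hi e` with probability at least `p`. -/
def Compatible {E : Type*} (lo hi : E → ℕ) (p : ℝ) (D : E → PMF ℕ) : Prop :=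
  ∀ e, (∀ k ∈ (D e).support, lo e ≤ k ∧ k ≤ hi e) ∧ ENNReal.ofReal p ≤ D e (hi e)

/-- The joint law of independent weights, the weight of `e` having law `D e`. -/
noncomputable def weightLaw {E : Type*} [Fintype E] (D : E → PMF ℕ) : Measure (E → ℕ) :=
  Measure.pi fun e => (D e).toMeasure

/-- The probability that the randomized algorithm `A` (a random deterministic algorithm, drawn
independently of the weights) returns a set that is good for the realized weights. -/
noncomputable def successProb {E : Type*} [Fintype E] (A : PMF (QueryTree E)) (D : E → PMF ℕ)
    (good : (E → ℕ) → Finset E → Prop) : ENNReal :=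
  ∑' t : QueryTree E, A t * weightLaw D {c | good c (t.result c)}

end StochasticMatching

/-! ### Integral duality for bipartite matching -/

namespace StochasticMatching

/-! The algorithm is deterministic and optimistic. Each round queries a maximum matching for the
current upper bounds, hence at most one edge per vertex; at the end a maximum matching for the lower
bounds is returned. This succeeds once the optimum for the lower bounds is at least `1 - ε` times
the optimum `b` for the upper bounds.

Otherwise integral duality gives a vertex cover of the lower bounds with total below `(1 - ε) * b`.
Every queried matching had upper weight at least `b`, so at least about `ε * b / K` of its edges had
upper bounds exceeding the cover. Each such edge attains its upper bound with probability at least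
`p`, which refutes the cover. A fixed cover therefore survives all rounds only with tiny
probability.

A union bound over all covers would pay for every vertex of the graph. Instead, only the restriction
`z` to a set `U` is fixed, where `U` is the support of an optimal cover of the initial upper bounds
and has at most as many vertices as their optimum `μ`. Off `U`, `coverExt` takes the least values
forced by the current lower bounds. A slack edge that attains its upper bound then kills `z` or
raises the total of the extension, so `X ^ total` with `X ≤ 1 / 2` contracts in mean
(`weightLaw_witness_le`). The initial potentials, summed over `z`, are at most `exp (2 * x * |U|)`
(`sum_pow_sum_le`), which is affordable if `b ≥ x * μ`. Smaller `b` are excluded by a Chernoff bound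
for the first queried matching (`weightLaw_few_realized_le`).

As `ε * p` tends to `1` the query budget tends to `0`; there the initial optimistic matching is
returned without any query. -/

/-- Egerváry's theorem: for a natural-valued cover of least total, the tight entries satisfy Hall's
condition. -/
theorem exists_integral_dual {α : Type*} [Fintype α] (w : α → α → ℕ) :
    ∃ (u v : α → ℕ) (σ : α → α), (∀ i j, w i j ≤ u i + v j) ∧ Function.Injective σ ∧
      ∀ i, w i (σ i) = u i + v (σ i) := by
  classical
  have hex : ∃ n : ℕ, ∃ u v : α → ℕ, (∀ i j, w i j ≤ u i + v j) ∧ ∑ i, u i + ∑ j, v j = n :=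
    ⟨_, fun i => ∑ j, w i j, fun _ => 0, fun i j =>
      Finset.single_le_sum (f := fun j => w i j) (fun _ _ => Nat.zero_le _) (Finset.mem_univ j),
      rfl⟩
  obtain ⟨u, v, hcov, hsum⟩ := Nat.find_spec hex
  have hmin : ∀ u' v' : α → ℕ, (∀ i j, w i j ≤ u' i + v' j) →
      ∑ i, u i + ∑ j, v j ≤ ∑ i, u' i + ∑ j, v' j := fun u' v' h => by
    rw [hsum]; exact Nat.find_min' hex ⟨u', v', h, rfl⟩
  let t : α → Finset α := fun i => Finset.univ.filter fun j => w i j = u i + v j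
  have hall : ∀ S : Finset α, S.card ≤ (S.biUnion t).card := by
    intro S
    by_contra! hlt
    set N := S.biUnion t with hN
    have hslack : ∀ i ∈ S, ∀ j ∉ N, w i j + 1 ≤ u i + v j := by
      intro i hi j hj
      refine lt_of_le_of_ne (hcov i j) fun h => hj ?_
      exact Finset.mem_biUnion.2 ⟨i, hi, by simp [t, h]⟩
    -- A deficient `S` allows a shift that changes the total by `|N| - |S| < 0`. Lowering `u` on `S`
    -- needs `u ≥ 1` there. If some `u i₀ = 0`, slackness gives `v ≥ 1` off `N`, and raising `u` off
    -- `S` while lowering `v` off `N` has the same effect.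
    by_cases hpos : ∀ i ∈ S, 1 ≤ u i
    · have hs : ∀ i, (if i ∈ S then u i - 1 else u i) + (if i ∈ S then 1 else 0) = u i := by
        intro i
        split_ifs with h
        · exact Nat.sub_add_cancel (hpos i h)
        · rfl
      have key := hmin (fun i => if i ∈ S then u i - 1 else u i)
        (fun j => v j + if j ∈ N then 1 else 0) (by
          intro i j
          have h1 := hcov i j
          by_cases hi : i ∈ S <;> by_cases hj : j ∈ N <;> simp only [hi, hj, if_true, if_false]
          · omega
          · have := hslack i hi j hj
            omega
          · omega
          · omega)
      have h2 : ∑ i, u i = ∑ i, (if i ∈ S then u i - 1 else u i) + S.card := by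
        rw [← Finset.sum_congr rfl fun i _ => hs i, Finset.sum_add_distrib]
        simp
      rw [Finset.sum_add_distrib, h2] at key
      simp only [Finset.sum_ite_mem, Finset.univ_inter, Finset.sum_const, smul_eq_mul,
        mul_one] at key
      omega
    · push Not at hpos
      obtain ⟨i₀, hi₀, hu⟩ := hpos
      have hv : ∀ j, j ∉ N → 1 ≤ v j := by
        intro j hj
        have := hslack i₀ hi₀ j hj
        omega
      have hs : ∀ j, (if j ∈ Nᶜ then v j - 1 else v j) + (if j ∈ Nᶜ then 1 else 0) = v j := by
        intro i
        split_ifs with h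
        · exact Nat.sub_add_cancel (hv i (Finset.mem_compl.1 h))
        · rfl
      have key := hmin (fun i => u i + if i ∈ Sᶜ then 1 else 0)
        (fun j => if j ∈ Nᶜ then v j - 1 else v j) (by
          intro i j
          have h1 := hcov i j
          by_cases hi : i ∈ S <;> by_cases hj : j ∈ N <;>
            simp only [Finset.mem_compl, hi, hj, if_true, if_false, not_true, not_false_eq_true]
          · omega
          · have := hslack i hi j hj
            omega
          · omega
          · have := hv j hj
            omega)
      have h2 : ∑ j, v j = ∑ j, (if j ∈ Nᶜ then v j - 1 else v j) + Nᶜ.card := by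
        rw [← Finset.sum_congr rfl fun i _ => hs i, Finset.sum_add_distrib, Finset.sum_ite_mem,
          Finset.univ_inter, Finset.card_eq_sum_ones]
      rw [Finset.sum_add_distrib, h2] at key
      simp only [Finset.sum_ite_mem, Finset.univ_inter, Finset.sum_const, smul_eq_mul,
        mul_one] at key
      have h3 := Finset.card_add_card_compl S
      have h4 := Finset.card_add_card_compl N
      omega
  obtain ⟨σ, hσ, hmem⟩ := (Finset.all_card_le_biUnion_card_iff_exists_injective t).1 hall
  exact ⟨u, v, σ, hcov, hσ, fun i => (Finset.mem_filter.1 (hmem i)).2⟩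

/-- A set of edges with endpoint maps `l` and `r` on which both maps are injective. -/
def EndpointInjective {E V : Type*} (l r : E → V) (M : Finset E) : Prop :=
  Set.InjOn l M ∧ Set.InjOn r M

section MaxMatching

variable {E V : Type*} [Fintype E] (l r : E → V)

theorem exists_maxMatching (w : E → ℕ) : ∃ M : Finset E, EndpointInjective l r M ∧
    ∀ N, EndpointInjective l r N → ∑ e ∈ N, w e ≤ ∑ e ∈ M, w e := by
  classical
  obtain ⟨M, hM, hmax⟩ := Finset.exists_max_image
    (Finset.univ.filter fun M : Finset E => EndpointInjective l r M) (fun M => ∑ e ∈ M, w e)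
    ⟨∅, by rw [Finset.mem_filter]; simp [EndpointInjective]⟩
  exact ⟨M, (Finset.mem_filter.1 hM).2, fun N hN => hmax N (by simp [hN])⟩

noncomputable def maxMatching (w : E → ℕ) : Finset E := (exists_maxMatching l r w).choose

/-- The maximum weight of a matching. -/
noncomputable def maxWeight (w : E → ℕ) : ℕ := ∑ e ∈ maxMatching l r w, w e

theorem maxMatching_endpointInjective (w : E → ℕ) :
    EndpointInjective l r (maxMatching l r w) := (exists_maxMatching l r w).choose_spec.1

variable {l r} in
theorem EndpointInjective.sum_le_maxWeight {N : Finset E} (hN : EndpointInjective l r N)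
    (w : E → ℕ) : ∑ e ∈ N, w e ≤ maxWeight l r w := (exists_maxMatching l r w).choose_spec.2 N hN

theorem maxWeight_mono {w w' : E → ℕ} (h : ∀ e, w e ≤ w' e) :
    maxWeight l r w ≤ maxWeight l r w' :=
  (Finset.sum_le_sum fun e _ => h e).trans
    ((maxMatching_endpointInjective l r w).sum_le_maxWeight w')

variable {l r} in
-- Vertices index both sides of a square matrix, with entry zero where there is no edge. The
-- positive entries of a tight assignment give a matching, and as left and right ends are disjoint,
-- one vector can carry both `u` and `v`.
theorem exists_cover_le_maxWeight [Fintype V] (hlr : ∀ e f, l e ≠ r f) (w : E → ℕ) :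
    ∃ y : V → ℕ, (∀ e, w e ≤ y (l e) + y (r e)) ∧ ∑ x, y x ≤ maxWeight l r w := by
  classical
  let W : V → V → ℕ := fun i j => (Finset.univ.filter fun e => l e = i ∧ r e = j).sup w
  obtain ⟨u, v, σ, hcov, hσ, htight⟩ := exists_integral_dual W
  have hbij : Function.Bijective σ := Finite.injective_iff_bijective.1 hσ
  refine ⟨fun x => if x ∈ Set.range l then u x else v x, fun e => ?_, ?_⟩
  · have h1 : r e ∉ Set.range l := fun ⟨f, hf⟩ => hlr f e hf
    simp only [Set.mem_range_self, if_true, h1, if_false]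
    exact (Finset.le_sup (f := w) (by simp)).trans (hcov (l e) (r e))
  · let P : Finset V := Finset.univ.filter fun i => 0 < W i (σ i)
    have hsel : ∀ i : P, ∃ e, l e = i ∧ r e = σ i ∧ w e = W i (σ i) := by
      rintro ⟨i, hi⟩
      have hi' : 0 < W i (σ i) := (Finset.mem_filter.1 hi).2
      have hne : (Finset.univ.filter fun e => l e = i ∧ r e = σ i).Nonempty := by
        rw [Finset.nonempty_iff_ne_empty]
        intro h
        simp [W, h] at hi'
      obtain ⟨e, he, heq⟩ := Finset.exists_mem_eq_sup _ hne w
      obtain ⟨h1, h2⟩ := (Finset.mem_filter.1 he).2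
      exact ⟨e, h1, h2, heq.symm⟩
    choose g hgl hgr hgw using hsel
    have hginj : Function.Injective g := fun i j h => Subtype.ext (by
      rw [← hgl i, ← hgl j, h])
    have hM : EndpointInjective l r (Finset.univ.image g) := by
      constructor <;> rw [Finset.coe_image] <;> rintro _ ⟨i, -, rfl⟩ _ ⟨j, -, rfl⟩ h
      · rw [hgl i, hgl j] at h
        rw [Subtype.ext h]
      · rw [hgr i, hgr j] at h
        rw [Subtype.ext (hσ h)]
    calc ∑ x, (if x ∈ Set.range l then u x else v x) ≤ ∑ x, (u x + v x) :=
          Finset.sum_le_sum fun x _ => by split_ifs <;> omega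
      _ = ∑ x, W x (σ x) := by
          simp_rw [htight, Finset.sum_add_distrib]
          rw [hbij.sum_comp v]
      _ = ∑ x ∈ P, W x (σ x) := by
          refine (Finset.sum_subset (Finset.subset_univ _) fun x _ hx => ?_).symm
          simpa [P] using hx
      _ = ∑ e ∈ Finset.univ.image g, w e := by
          rw [Finset.sum_image hginj.injOn, ← Finset.sum_coe_sort]
          exact Finset.sum_congr rfl fun i _ => (hgw i).symm
      _ ≤ _ := hM.sum_le_maxWeight w

end MaxMatching
-- Independent weights: conditioning and tail bounds
section Law

variable {E : Type*} [Fintype E]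

instance (D : E → PMF ℕ) : IsProbabilityMeasure (weightLaw D) := by
  unfold weightLaw; infer_instance

theorem weightLaw_singleton (D : E → PMF ℕ) (c : E → ℕ) : weightLaw D {c} = ∏ e, D e (c e) := by
  simp [weightLaw, Measure.pi_singleton, PMF.toMeasure_apply_singleton]

theorem lintegral_weightLaw (D : E → PMF ℕ) (f : (E → ℕ) → ENNReal) :
    ∫⁻ c, f c ∂weightLaw D = ∑' c, f c * ∏ e, D e (c e) := by
  simp_rw [lintegral_countable', weightLaw_singleton]

/-- Conditioning independent weights on the weight of one item. -/
theorem lintegral_weightLaw_condition [DecidableEq E] (D : E → PMF ℕ) (e : E)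
    (f : ℕ → (E → ℕ) → ENNReal) :
    ∫⁻ c, f (c e) c ∂weightLaw D =
      ∑' k, D e k * ∫⁻ c, f k c ∂weightLaw (Function.update D e (PMF.pure k)) := by
  simp_rw [lintegral_weightLaw, ← ENNReal.tsum_mul_left]
  rw [ENNReal.tsum_comm]
  refine tsum_congr fun c => ?_
  have h : ∀ k, ∏ e', Function.update D e (PMF.pure k) e' (c e') =
      (if c e = k then 1 else 0) * ∏ e' ∈ Finset.univ.erase e, D e' (c e') := by
    intro k
    rw [← Finset.mul_prod_erase _ _ (Finset.mem_univ e)]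
    congr 1
    · simp [PMF.pure_apply]
    · refine Finset.prod_congr rfl fun e' he' => ?_
      rw [Function.update_of_ne (Finset.ne_of_mem_erase he')]
  rw [tsum_eq_single (c e)]
  · rw [h, if_pos rfl, one_mul, ← Finset.mul_prod_erase _ _ (Finset.mem_univ e)]
    ring
  · intro k hk
    rw [h, if_neg hk.symm]
    simp

theorem weightLaw_condition [DecidableEq E] (D : E → PMF ℕ) (e : E)
    (P : ℕ → (E → ℕ) → Prop) :
    weightLaw D {c | P (c e) c} =
      ∑' k, D e k * weightLaw (Function.update D e (PMF.pure k)) {c | P k c} := by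
  classical
  have h : ∀ (D : E → PMF ℕ) (Q : (E → ℕ) → Prop),
      weightLaw D {c | Q c} = ∫⁻ c, (if Q c then 1 else 0) ∂weightLaw D := by
    intro D Q
    rw [← lintegral_indicator_one (MeasurableSet.of_discrete)]
    rfl
  simp_rw [h]
  exact lintegral_weightLaw_condition D e fun k c => if P k c then 1 else 0

theorem ae_mem_support (D : E → PMF ℕ) : ∀ᵐ c ∂weightLaw D, ∀ e, c e ∈ (D e).support := by
  refine ae_iff_of_countable.2 fun c hc e he => hc ?_
  rw [weightLaw_singleton]
  exact Finset.prod_eq_zero (Finset.mem_univ e) he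

/-- A one-step supermartingale estimate. -/
theorem tsum_mul_le_of_halved (d : PMF ℕ) (W : ℕ → ENNReal) (w : ENNReal) (h : ℕ) (p : ℝ)
    (hp0 : 0 ≤ p) (hp : ENNReal.ofReal p ≤ d h) (hW : ∀ k ∈ d.support, W k ≤ w)
    (hh : 2 * W h ≤ w) (hw : w ≠ ⊤) : ∑' k, d k * W k ≤ ENNReal.ofReal (1 - p / 2) * w := by
  have hp1 : p ≤ 1 := by
    have := hp.trans (d.coe_le_one h)
    simpa using this
  -- At the atom `h` the value is at most `w / 2`, which leaves room for the extra term.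
  have h1 : ∑' k, d k * W k + d h * (w / 2) ≤ w := by
    calc ∑' k, d k * W k + d h * (w / 2)
        = ∑' k, (d k * W k + if k = h then d h * (w / 2) else 0) := by
          rw [ENNReal.tsum_add, tsum_ite_eq]
      _ ≤ ∑' k, d k * w := by
          refine ENNReal.tsum_le_tsum fun k => ?_
          split_ifs with hk
          · subst hk
            rw [← mul_add]
            gcongr
            have : W k ≤ w / 2 := by
              rw [ENNReal.le_div_iff_mul_le (by simp) (by simp), mul_comm]
              exact hh
            calc W k + w / 2 ≤ w / 2 + w / 2 := by gcongr
              _ = w := ENNReal.add_halves w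
          · rw [add_zero]
            by_cases hd : d k = 0
            · simp [hd]
            · gcongr
              exact hW k hd
      _ = w := by rw [ENNReal.tsum_mul_right, d.tsum_coe, one_mul]
  have h2 : ∑' k, d k * W k + ENNReal.ofReal (p / 2) * w ≤ w := by
    refine le_trans (add_le_add le_rfl ?_) h1
    calc ENNReal.ofReal (p / 2) * w = ENNReal.ofReal p * (w / 2) := by
          rw [ENNReal.ofReal_div_of_pos two_pos, ENNReal.ofReal_ofNat, div_eq_mul_inv, div_eq_mul_inv]
          ring
      _ ≤ _ := by gcongr
  rw [ENNReal.ofReal_sub _ (by positivity), ENNReal.ofReal_one, ENNReal.sub_mul (fun _ _ => hw), one_mul]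
  exact ENNReal.le_sub_of_add_le_right (ENNReal.mul_ne_top ENNReal.ofReal_ne_top hw) h2

omit [Fintype E] in
-- Conditioning on a revealed weight yields an instance of the same kind, so inductions over queries
-- close, even with repeated queries.
theorem Compatible.update [DecidableEq E] {lo hi : E → ℕ} {p : ℝ} {D : E → PMF ℕ}
    (hD : Compatible lo hi p D) (hp : p ≤ 1) (e : E) (k : ℕ) :
    Compatible (Function.update lo e k) (Function.update hi e k) p
      (Function.update D e (PMF.pure k)) := by
  intro f
  by_cases hf : f = e
  · subst hf
    simpa using hp
  · simp_rw [Function.update_of_ne hf]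
    exact hD f

/-- The exponential moment behind the Chernoff bound: an item with positive upper bound has factor
at most `1 / 2` with probability at least `p`. -/
theorem lintegral_prod_half_pow_le (hi : E → ℕ) (p : ℝ) (hp0 : 0 ≤ p) (M : Finset E) :
    ∀ D : E → PMF ℕ, (∀ e ∈ M, ENNReal.ofReal p ≤ D e (hi e)) →
      ∫⁻ c, ∏ e ∈ M, (2⁻¹ : ENNReal) ^ c e ∂weightLaw D ≤
        ENNReal.ofReal (1 - p / 2) ^ (M.filter fun e => 1 ≤ hi e).card := by
  classical
  induction M using Finset.induction_on with
  | empty => simp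
  | insert e M he ih =>
    intro D hD
    simp_rw [Finset.prod_insert he]
    rw [lintegral_weightLaw_condition D e
      fun k c => (2⁻¹ : ENNReal) ^ k * ∏ e ∈ M, (2⁻¹ : ENNReal) ^ c e]
    have hcond : ∀ k, ∫⁻ c, (2⁻¹ : ENNReal) ^ k * ∏ e ∈ M, (2⁻¹ : ENNReal) ^ c e
          ∂weightLaw (Function.update D e (PMF.pure k)) ≤
        (2⁻¹ : ENNReal) ^ k * ENNReal.ofReal (1 - p / 2) ^ (M.filter fun e => 1 ≤ hi e).card := by
      intro k
      rw [lintegral_const_mul _ (measurable_of_countable _)]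
      gcongr
      refine ih _ fun f hf => ?_
      rw [Function.update_of_ne (ne_of_mem_of_not_mem hf he)]
      exact hD f (Finset.mem_insert_of_mem hf)
    have hpow : ∀ k : ℕ, (2⁻¹ : ENNReal) ^ k ≤ 1 := fun k => pow_le_one' (by simp) k
    calc _ ≤ ∑' k, D e k * ((2⁻¹ : ENNReal) ^ k *
          ENNReal.ofReal (1 - p / 2) ^ (M.filter fun e => 1 ≤ hi e).card) :=
          ENNReal.tsum_le_tsum fun k => mul_le_mul_right (hcond k) _
      _ = (∑' k, D e k * (2⁻¹ : ENNReal) ^ k) *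
          ENNReal.ofReal (1 - p / 2) ^ (M.filter fun e => 1 ≤ hi e).card := by
          simp_rw [← mul_assoc, ENNReal.tsum_mul_right]
      _ ≤ _ := by
          rw [Finset.filter_insert]
          split_ifs with hpos
          · rw [Finset.card_insert_of_notMem (fun h => he (Finset.mem_filter.1 h).1), pow_succ']
            gcongr
            rw [← mul_one (ENNReal.ofReal (1 - p / 2))]
            refine tsum_mul_le_of_halved (D e) _ 1 (hi e) p hp0 (hD e (Finset.mem_insert_self _ _))
              (fun k _ => hpow k) ?_ (by simp)
            obtain ⟨j, hj⟩ := Nat.exists_eq_add_of_le' hpos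
            rw [hj, pow_succ', ← mul_assoc, ENNReal.mul_inv_cancel (by simp) (by simp), one_mul]
            exact hpow j
          · conv_rhs => rw [← one_mul (_ ^ _)]
            gcongr
            calc ∑' k, D e k * (2⁻¹ : ENNReal) ^ k ≤ ∑' k, D e k * 1 :=
                  ENNReal.tsum_le_tsum fun k => mul_le_mul_right (hpow k) _
              _ = 1 := by simp [(D e).tsum_coe]

/-- A lower tail bound for the total weight of a set of items. -/
theorem weightLaw_sum_lt_le {hi : E → ℕ} {p : ℝ} {D : E → PMF ℕ} (hp0 : 0 ≤ p) (hp1 : p ≤ 1)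
    (hD : ∀ e, ENNReal.ofReal p ≤ D e (hi e)) (M : Finset E) (a : ℝ) (N : ℕ)
    (hN : N ≤ (M.filter fun e => 1 ≤ hi e).card) :
    weightLaw D {c | ((∑ e ∈ M, c e : ℕ) : ℝ) < a} ≤
      ENNReal.ofReal ((2 : ℝ) ^ a * (1 - p / 2) ^ N) := by
  have hq0 : 0 ≤ 1 - p / 2 := by linarith
  calc weightLaw D {c | ((∑ e ∈ M, c e : ℕ) : ℝ) < a}
      = ∫⁻ c, Set.indicator {c | ((∑ e ∈ M, c e : ℕ) : ℝ) < a} 1 c ∂weightLaw D :=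
        (lintegral_indicator_one MeasurableSet.of_discrete).symm
    -- Markov's inequality for `2 ^ (a - ∑ c e)`.
    _ ≤ ∫⁻ c, ENNReal.ofReal (2 ^ a) * ∏ e ∈ M, (2⁻¹ : ENNReal) ^ c e ∂weightLaw D := by
        refine lintegral_mono fun c => ?_
        rw [Set.indicator_apply]
        split_ifs with hc
        swap
        · exact zero_le
        have h2 : (2⁻¹ : ENNReal) = ENNReal.ofReal 2⁻¹ := by
          rw [ENNReal.ofReal_inv_of_pos two_pos, ENNReal.ofReal_ofNat]
        rw [Finset.prod_pow_eq_pow_sum, h2, ← ENNReal.ofReal_pow (by norm_num),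
          ← ENNReal.ofReal_mul (by positivity), Pi.one_apply, ENNReal.one_le_ofReal,
          inv_pow, ← Real.rpow_natCast, ← Real.rpow_neg two_pos.le, ← Real.rpow_add two_pos]
        refine Real.one_le_rpow one_le_two ?_
        have : ((∑ e ∈ M, c e : ℕ) : ℝ) < a := hc
        linarith
    _ = ENNReal.ofReal (2 ^ a) * ∫⁻ c, ∏ e ∈ M, (2⁻¹ : ENNReal) ^ c e ∂weightLaw D :=
        lintegral_const_mul _ (measurable_of_countable _)
    _ ≤ ENNReal.ofReal (2 ^ a) *
          ENNReal.ofReal (1 - p / 2) ^ (M.filter fun e => 1 ≤ hi e).card := by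
        gcongr
        exact lintegral_prod_half_pow_le hi p hp0 M D fun e _ => hD e
    _ ≤ _ := by
        rw [← ENNReal.ofReal_pow hq0, ← ENNReal.ofReal_mul (by positivity)]
        refine ENNReal.ofReal_le_ofReal ?_
        gcongr ?_ * ?_
        exact pow_le_pow_of_le_one hq0 (by linarith) hN

end Law
/-- The known bounds on the hidden weights. -/
structure Knowledge (E : Type*) where
  lo : E → ℕ
  hi : E → ℕ

open Classical in
theorem countP_toList {E : Type*} (P : E → Prop) (M : Finset E) :
    M.toList.countP (fun e => P e) = (M.filter P).card := by
  rw [Finset.card_def, Finset.filter_val, ← Multiset.countP_eq_card_filter, ← Finset.coe_toList,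
    Multiset.coe_countP]

/-! ### The optimistic algorithm and its query count -/

section Algorithm

variable {E V : Type*}

open Classical in
noncomputable def Knowledge.update (s : Knowledge E) (e : E) (k : ℕ) : Knowledge E :=
  ⟨Function.update s.lo e k, Function.update s.hi e k⟩

noncomputable def Knowledge.observe : List E → Knowledge E → (E → ℕ) → Knowledge E
  | [], s, _ => s
  | e :: L, s, c => observe L (s.update e (c e)) c

theorem Knowledge.observe_bounds (c : E → ℕ) : ∀ (L : List E) (s : Knowledge E),
    (∀ e, s.lo e ≤ c e ∧ c e ≤ s.hi e) →
    ∀ e, s.lo e ≤ (observe L s c).lo e ∧ (observe L s c).lo e ≤ c e ∧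
      c e ≤ (observe L s c).hi e ∧ (observe L s c).hi e ≤ s.hi e
  | [], s, h, e => ⟨le_rfl, (h e).1, (h e).2, le_rfl⟩
  | f :: L, s, h, e => by
    have hf : ∀ e, s.lo e ≤ (s.update f (c f)).lo e ∧ (s.update f (c f)).lo e ≤ c e ∧
        c e ≤ (s.update f (c f)).hi e ∧ (s.update f (c f)).hi e ≤ s.hi e := by
      intro e
      by_cases he : e = f
      · subst he
        simp [Knowledge.update, h]
      · simp [Knowledge.update, he, h]
    have ih := observe_bounds c L (s.update f (c f)) (fun e => ⟨(hf e).2.1, (hf e).2.2.1⟩) e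
    exact ⟨(hf e).1.trans ih.1, ih.2.1, ih.2.2.1, ih.2.2.2.trans (hf e).2.2.2⟩

/-- Query the items of a list in turn and go on with what has been learned. -/
noncomputable def queryAll (next : Knowledge E → QueryTree E) :
    List E → Knowledge E → QueryTree E
  | [], s => next s
  | e :: L, s => .query e fun k => queryAll next L (s.update e k)

theorem queryAll_result (next : Knowledge E → QueryTree E) (c : E → ℕ) :
    ∀ (L : List E) (s : Knowledge E),
      (queryAll next L s).result c = (next (s.observe L c)).result c
  | [], _ => rfl
  | _ :: L, _ => queryAll_result next c L _

open Classical in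
theorem queryAll_queryCount (next : Knowledge E → QueryTree E) (S : Set E) (c : E → ℕ) :
    ∀ (L : List E) (s : Knowledge E),
      (queryAll next L s).queryCount S c =
        L.countP (· ∈ S) + (next (s.observe L c)).queryCount S c
  | [], _ => by simp [queryAll, Knowledge.observe]
  | e :: L, s => by
    rw [queryAll, QueryTree.queryCount, queryAll_queryCount next S c L, List.countP_cons,
      Knowledge.observe]
    simp only [decide_eq_true_eq]
    omega

variable [Fintype E] (l r : E → V)

/-- Query optimistic maximum matchings for `n` rounds and return a pessimistic one. -/
noncomputable def matchingRounds : ℕ → Knowledge E → QueryTree E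
  | 0, s => .output (maxMatching l r s.lo)
  | n + 1, s => queryAll (matchingRounds n) (maxMatching l r s.hi).toList s

/-- What is known after `n` rounds. -/
noncomputable def knowledgeAfter : ℕ → Knowledge E → (E → ℕ) → Knowledge E
  | 0, s, _ => s
  | n + 1, s, c => knowledgeAfter n (s.observe (maxMatching l r s.hi).toList c) c

theorem matchingRounds_result (c : E → ℕ) : ∀ (n : ℕ) (s : Knowledge E),
    (matchingRounds l r n s).result c = maxMatching l r (knowledgeAfter l r n s c).lo
  | 0, _ => rfl
  | n + 1, s => by
    rw [matchingRounds, queryAll_result, matchingRounds_result c n, knowledgeAfter]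

theorem knowledgeAfter_bounds (c : E → ℕ) : ∀ (n : ℕ) (s : Knowledge E),
    (∀ e, s.lo e ≤ c e ∧ c e ≤ s.hi e) →
    ∀ e, s.lo e ≤ (knowledgeAfter l r n s c).lo e ∧ (knowledgeAfter l r n s c).lo e ≤ c e ∧
      c e ≤ (knowledgeAfter l r n s c).hi e ∧ (knowledgeAfter l r n s c).hi e ≤ s.hi e
  | 0, s, h, e => ⟨le_rfl, (h e).1, (h e).2, le_rfl⟩
  | n + 1, s, h, e => by
    have h1 := Knowledge.observe_bounds c (maxMatching l r s.hi).toList s h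
    have h2 := knowledgeAfter_bounds c n _ (fun e => ⟨(h1 e).2.1, (h1 e).2.2.1⟩) e
    exact ⟨(h1 e).1.trans h2.1, h2.2.1, h2.2.2.1, h2.2.2.2.trans (h1 e).2.2.2⟩

open Classical in
theorem matchingRounds_queryCount_le (S : Set E)
    (hS : ∀ M : Finset E, EndpointInjective l r M → ∀ e ∈ M, ∀ f ∈ M, e ∈ S → f ∈ S → e = f) (c : E → ℕ) :
    ∀ (n : ℕ) (s : Knowledge E), (matchingRounds l r n s).queryCount S c ≤ n
  | 0, _ => le_rfl
  | n + 1, s => by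
    rw [matchingRounds, queryAll_queryCount]
    have h1 := matchingRounds_queryCount_le S hS c n (s.observe (maxMatching l r s.hi).toList c)
    have h2 : ((maxMatching l r s.hi).filter (· ∈ S)).card ≤ 1 := by
      refine Finset.card_le_one.2 fun e he f hf => ?_
      rw [Finset.mem_filter] at he hf
      exact hS _ (maxMatching_endpointInjective l r s.hi) e he.1 f hf.1 he.2 hf.2
    rw [countP_toList (· ∈ S)]
    omega

end Algorithm

/-! ### Witnesses of failure and their potential -/

section Potential

variable {E V : Type*} [Fintype E] (l r : E → V) (U : Set V) (z : V → ℕ)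

open Classical in
/-- The least extension to a cover of `w` of a vector `z` that is prescribed on `U`. -/
noncomputable def coverExt (w : E → ℕ) (x : V) : ℕ :=
  if x ∈ U then z x else Finset.univ.sup fun e =>
    max (if l e = x then w e - z (r e) else 0) (if r e = x then w e - z (l e) else 0)

theorem coverExt_mono {w w' : E → ℕ} (h : ∀ e, w e ≤ w' e) (x : V) :
    coverExt l r U z w x ≤ coverExt l r U z w' x := by
  unfold coverExt
  split_ifs
  · exact le_rfl
  · refine Finset.sup_mono_fun fun e _ => ?_
    have := h e
    refine max_le_max ?_ ?_ <;> split_ifs <;> omega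

theorem coverExt_congr {w w' : E → ℕ} (x : V) (h : ∀ e, l e = x ∨ r e = x → w e = w' e) :
    coverExt l r U z w x = coverExt l r U z w' x := by
  unfold coverExt
  split_ifs
  · rfl
  · refine Finset.sup_congr rfl fun e _ => ?_
    by_cases h1 : l e = x
    · simp [h1, h e (.inl h1)]
    · by_cases h2 : r e = x
      · simp [h2, h e (.inr h2)]
      · simp [h1, h2]

theorem le_coverExt_left (w : E → ℕ) (e : E) (h : l e ∉ U) :
    w e ≤ coverExt l r U z w (l e) + z (r e) := by
  classical
  rw [coverExt, if_neg h, ← Nat.sub_le_iff_le_add]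
  refine le_trans ?_ (Finset.le_sup (Finset.mem_univ e))
  simp

theorem le_coverExt_right (w : E → ℕ) (e : E) (h : r e ∉ U) :
    w e ≤ coverExt l r U z w (r e) + z (l e) := by
  classical
  rw [coverExt, if_neg h, ← Nat.sub_le_iff_le_add]
  refine le_trans ?_ (Finset.le_sup (Finset.mem_univ e))
  simp

theorem le_coverExt (hz : ∀ x ∉ U, z x = 0) (w : E → ℕ) (x : V) :
    z x ≤ coverExt l r U z w x := by
  by_cases hx : x ∈ U
  · simp [coverExt, hx]
  · simp [hz x hx]

/-- Here `U` has to meet every edge of nonzero weight: an edge with a demand at `x ∉ U` has its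
other end in `U`, where `z` agrees with `y`. -/
theorem coverExt_le (w : E → ℕ) (y : V → ℕ) (hy : ∀ e, w e ≤ y (l e) + y (r e))
    (hU : ∀ e, w e ≠ 0 → l e ∈ U ∨ r e ∈ U) (hz : ∀ x ∈ U, z x = y x) (x : V) :
    coverExt l r U z w x ≤ y x := by
  unfold coverExt
  split_ifs with hx
  · exact (hz x hx).le
  · refine Finset.sup_le fun e _ => max_le ?_ ?_
    · split_ifs with h
      · subst h
        by_cases hw : w e = 0
        · simp [hw]
        · have := hz _ ((hU e hw).resolve_left hx)
          have := hy e
          omega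
      · exact Nat.zero_le _
    · split_ifs with h
      · subst h
        by_cases hw : w e = 0
        · simp [hw]
        · have := hz _ ((hU e hw).resolve_right hx)
          have := hy e
          omega
      · exact Nat.zero_le _

/-- The upper bound on the weight of `e` is not covered by the extension of `z`. -/
def Slack (s : Knowledge E) (e : E) : Prop :=
  coverExt l r U z s.lo (l e) + coverExt l r U z s.lo (r e) < s.hi e

variable [Fintype V]

/-- The vector `z` extends to a cover of the lower bounds of total less than `(1 - ε) * b`, and the
upper bounds allow a matching of weight `b`. -/
def Witness (ε : ℝ) (b : ℕ) (s : Knowledge E) : Prop :=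
  (∀ e, (l e ∈ U ↔ r e ∈ U) → s.lo e ≤ z (l e) + z (r e)) ∧
    ((∑ x, coverExt l r U z s.lo x : ℕ) : ℝ) < (1 - ε) * b ∧ b ≤ maxWeight l r s.hi

open Classical in
noncomputable def potential (ε : ℝ) (b : ℕ) (X : ENNReal) (s : Knowledge E) : ENNReal :=
  if Witness l r U z ε b s then X ^ ∑ x, coverExt l r U z s.lo x else 0

variable {l r U z} {ε : ℝ} {b : ℕ} {X : ENNReal}

/-- Queries only raise lower bounds and reduce upper bounds, so a dead witness never revives. -/
theorem Witness.of_update {s : Knowledge E} {e : E} {k : ℕ} (h1 : s.lo e ≤ k) (h2 : k ≤ s.hi e)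
    (h : Witness l r U z ε b (s.update e k)) : Witness l r U z ε b s := by
  have hlo : ∀ f, s.lo f ≤ (s.update e k).lo f := fun f => by
    by_cases hf : f = e
    · subst hf; simpa [Knowledge.update] using h1
    · simp [Knowledge.update, hf]
  have hhi : ∀ f, (s.update e k).hi f ≤ s.hi f := fun f => by
    by_cases hf : f = e
    · subst hf; simpa [Knowledge.update] using h2
    · simp [Knowledge.update, hf]
  refine ⟨fun f hf => (hlo f).trans (h.1 f hf), lt_of_le_of_lt ?_ h.2.1,
    h.2.2.trans (maxWeight_mono l r hhi)⟩
  exact_mod_cast Finset.sum_le_sum fun x _ => coverExt_mono l r U z hlo x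

theorem potential_update_le (hX : X ≤ 1) {s : Knowledge E} {e : E} {k : ℕ} (h1 : s.lo e ≤ k)
    (h2 : k ≤ s.hi e) : potential l r U z ε b X (s.update e k) ≤ potential l r U z ε b X s := by
  unfold potential
  split_ifs with h h' h'
  · refine pow_le_pow_right_of_le_one' hX (Finset.sum_le_sum fun x _ => coverExt_mono l r U z ?_ x)
    intro f
    by_cases hf : f = e
    · subst hf; simpa [Knowledge.update] using h1
    · simp [Knowledge.update, hf]
  · exact absurd (h.of_update h1 h2) h'
  · exact zero_le
  · exact le_rfl

/-- If exactly one end of `e` lies in `U`, the revealed value forces the extension up at the other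
end. Otherwise it violates the first clause of `Witness`, and the potential drops to `0`. -/
theorem potential_update_hi_le (hX : X ≤ 1) (hz : ∀ x ∉ U, z x = 0) {s : Knowledge E} {e : E}
    (h1 : s.lo e ≤ s.hi e) (hs : Slack l r U z s e) :
    potential l r U z ε b X (s.update e (s.hi e)) ≤ X * potential l r U z ε b X s := by
  have hlo : ∀ f, s.lo f ≤ (s.update e (s.hi e)).lo f := fun f => by
    by_cases hf : f = e
    · subst hf; simpa [Knowledge.update] using h1
    · simp [Knowledge.update, hf]
  have hle : (s.update e (s.hi e)).lo e = s.hi e := by simp [Knowledge.update]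
  unfold potential
  by_cases h : Witness l r U z ε b (s.update e (s.hi e))
  swap
  · simp [h]
  rw [if_pos h, if_pos (h.of_update h1 le_rfl), ← pow_succ']
  refine pow_le_pow_right_of_le_one' hX ?_
  have hzl := le_coverExt l r U z hz s.lo (l e)
  have hzr := le_coverExt l r U z hz s.lo (r e)
  unfold Slack at hs
  have hdiff : ¬ (l e ∈ U ↔ r e ∈ U) := fun hiff => by
    have := h.1 e hiff
    rw [hle] at this
    omega
  refine Finset.sum_lt_sum (fun x _ => coverExt_mono l r U z hlo x) ?_
  by_cases hl : l e ∈ U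
  · have hr : r e ∉ U := by tauto
    refine ⟨r e, Finset.mem_univ _, ?_⟩
    have := le_coverExt_right l r U z (s.update e (s.hi e)).lo e hr
    rw [hle] at this
    omega
  · refine ⟨l e, Finset.mem_univ _, ?_⟩
    have := le_coverExt_left l r U z (s.update e (s.hi e)).lo e hl
    rw [hle] at this
    omega

omit [Fintype V] in
-- The extension at a vertex depends only on incident edges, so the slack edges counted at the start
-- of a round stay slack while other edges of the same matching are queried.
theorem slack_update_iff (hlr : ∀ e f, l e ≠ r f) {s : Knowledge E} {e f : E} {k : ℕ}
    (hl : l f ≠ l e) (hr : r f ≠ r e) : Slack l r U z (s.update e k) f ↔ Slack l r U z s f := by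
  have hfe : f ≠ e := fun h => hl (by rw [h])
  have key : ∀ x, l e ≠ x → r e ≠ x →
      coverExt l r U z (s.update e k).lo x = coverExt l r U z s.lo x := by
    intro x h1 h2
    refine coverExt_congr l r U z x fun g hg => ?_
    have : g ≠ e := by
      rintro rfl
      tauto
    simp [Knowledge.update, this]
  unfold Slack
  rw [key _ hl.symm (hlr f e).symm, key _ (hlr e f) hr.symm]
  simp [Knowledge.update, hfe]

open Classical in
/-- A maximum matching for the upper bounds has many slack edges if there is a witness. -/
theorem Witness.le_card_slack (hlr : ∀ e f, l e ≠ r f) {s : Knowledge E} {K m : ℕ}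
    (h : Witness l r U z ε b s) (hK : ∀ e, s.hi e ≤ K) (hm : ((m : ℝ) - 1) * K < ε * b) :
    m ≤ ((maxMatching l r s.hi).filter (Slack l r U z s)).card := by
  set M := maxMatching l r s.hi with hM
  set y := coverExt l r U z s.lo with hy
  obtain ⟨hl, hr⟩ := maxMatching_endpointInjective l r s.hi
  have h1 : ∑ e ∈ M, (y (l e) + y (r e)) ≤ ∑ x, y x := by
    rw [Finset.sum_add_distrib, ← Finset.sum_image hl, ← Finset.sum_image (f := y) hr,
      ← Finset.sum_union]
    · exact Finset.sum_le_sum_of_subset (Finset.subset_univ _)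
    · rw [Finset.disjoint_left]
      simp only [Finset.mem_image]
      rintro _ ⟨e, -, rfl⟩ ⟨f, -, hf⟩
      exact hlr e f hf.symm
  -- The cover pays for edges that are not slack; a slack edge costs at most `K`.
  have h2 : ∑ e ∈ M, s.hi e ≤ ∑ e ∈ M, (y (l e) + y (r e)) +
      (M.filter (Slack l r U z s)).card * K := by
    rw [← smul_eq_mul, ← Finset.sum_const, Finset.sum_filter, ← Finset.sum_add_distrib]
    refine Finset.sum_le_sum fun e _ => ?_
    split_ifs with hs
    · exact (hK e).trans (Nat.le_add_left _ _)
    · simpa [Slack] using hs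
  have h3 : (b : ℝ) ≤ ((∑ x, y x : ℕ) : ℝ) + (M.filter (Slack l r U z s)).card * K := by
    have := h.2.2.trans (h2.trans (Nat.add_le_add_right h1 _))
    exact_mod_cast this
  have h4 := h.2.1
  by_contra! hlt
  have h5 : ((M.filter (Slack l r U z s)).card : ℝ) ≤ m - 1 := by
    have : (M.filter (Slack l r U z s)).card + 1 ≤ m := hlt
    have : (((M.filter (Slack l r U z s)).card : ℝ) + 1) ≤ m := by exact_mod_cast this
    linarith
  have h6 := mul_le_mul_of_nonneg_right h5 (Nat.cast_nonneg (α := ℝ) K)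
  linarith

end Potential
-- Survival probability of a fixed witness
section Survival

variable {E V : Type*} [Fintype E] [Fintype V] {l r : E → V} {U : Set V} {z : V → ℕ}
  {ε p : ℝ} {b : ℕ} {X : ENNReal}

open Classical in
-- One round, by induction over its queries. In the application `good` is survival of the remaining
-- rounds and `κ` is their decay; `X ^ b` is a floor for the potential of a live witness.
theorem weightLaw_observe_le (hlr : ∀ e f, l e ≠ r f) (hz : ∀ x ∉ U, z x = 0)
    (hX : 2 * X ≤ 1) (hp0 : 0 ≤ p) (hp1 : p ≤ 1) (K : ℕ) (κ : ENNReal)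
    (good : Knowledge E → (E → ℕ) → Prop)
    (hgood : ∀ (s : Knowledge E) (D : E → PMF ℕ), Compatible s.lo s.hi p D → (∀ e, s.hi e ≤ K) →
      X ^ b * weightLaw D {c | good s c} ≤ κ * potential l r U z ε b X s) :
    ∀ (L : List E), L.Pairwise (fun e f => l f ≠ l e ∧ r f ≠ r e) →
      ∀ (s : Knowledge E) (D : E → PMF ℕ), Compatible s.lo s.hi p D → (∀ e, s.hi e ≤ K) →
      X ^ b * weightLaw D {c | good (s.observe L c) c} ≤
        κ * (ENNReal.ofReal (1 - p / 2) ^ L.countP (fun e => Slack l r U z s e) *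
          potential l r U z ε b X s) := by
  have hX1 : X ≤ 1 := by
    refine le_trans ?_ hX
    rw [two_mul]
    exact le_self_add
  intro L
  induction L with
  | nil =>
    intro _ s D hD hK
    simpa [Knowledge.observe] using hgood s D hD hK
  | cons e L ih =>
    intro hL s D hD hK
    obtain ⟨hL1, hL2⟩ := List.pairwise_cons.1 hL
    have hstep := weightLaw_condition D e fun k c => good ((s.update e k).observe L c) c
    have hset : {c | good (s.observe (e :: L) c) c} =
      {c | good ((s.update e (c e)).observe L c) c} := rfl
    rw [hset, hstep, ← ENNReal.tsum_mul_left]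
    set q := ENNReal.ofReal (1 - p / 2) with hq
    have hcount : ∀ k, L.countP (fun f => Slack l r U z (s.update e k) f) =
        L.countP (fun f => Slack l r U z s f) := fun k =>
      List.countP_congr fun f hf => by
        simpa using slack_update_iff hlr (hL1 f hf).1 (hL1 f hf).2
    have hterm : ∀ k, X ^ b * (D e k * weightLaw (Function.update D e (PMF.pure k))
          {c | good ((s.update e k).observe L c) c}) ≤
        κ * q ^ L.countP (fun f => Slack l r U z s f) *
          (D e k * potential l r U z ε b X (s.update e k)) := by
      intro k
      by_cases hk : D e k = 0
      · simp [hk]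
      have hkb := (hD e).1 k hk
      have := ih hL2 (s.update e k) _ (hD.update hp1 e k) (by
        intro f
        by_cases hf : f = e
        · subst hf
          simpa [Knowledge.update] using hkb.2.trans (hK f)
        · simpa [Knowledge.update, hf] using hK f)
      rw [hcount] at this
      calc _ = D e k * (X ^ b * weightLaw (Function.update D e (PMF.pure k))
          {c | good ((s.update e k).observe L c) c}) := by ring
        _ ≤ D e k * _ := mul_le_mul_right this _
        _ = _ := by ring
    refine (ENNReal.tsum_le_tsum hterm).trans ?_
    rw [ENNReal.tsum_mul_left, List.countP_cons, pow_add, mul_assoc, mul_assoc]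
    refine mul_le_mul_right (mul_le_mul_right ?_ _) _
    have hmono : ∀ k ∈ (D e).support,
        potential l r U z ε b X (s.update e k) ≤ potential l r U z ε b X s := fun k hk =>
      potential_update_le hX1 ((hD e).1 k hk).1 ((hD e).1 k hk).2
    have htop : potential l r U z ε b X s ≠ ⊤ := by
      unfold potential
      split_ifs
      · exact ENNReal.pow_ne_top (ne_top_of_le_ne_top ENNReal.one_ne_top hX1)
      · exact ENNReal.zero_ne_top
    by_cases hs : Slack l r U z s e
    · simp only [hs, decide_true, if_true, pow_one]
      obtain ⟨k, hk⟩ := (D e).support_nonempty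
      have hlohi := ((hD e).1 k hk).1.trans ((hD e).1 k hk).2
      refine tsum_mul_le_of_halved (D e) _ _ (s.hi e) p hp0 (hD e).2 hmono ?_ htop
      calc _ ≤ 2 * (X * potential l r U z ε b X s) :=
            mul_le_mul_right (potential_update_hi_le hX1 hz hlohi hs) _
        _ = 2 * X * potential l r U z ε b X s := by ring
        _ ≤ 1 * potential l r U z ε b X s := mul_le_mul_left hX _
        _ = _ := one_mul _
    · simp only [hs, decide_false, Bool.false_eq_true, if_false, pow_zero, one_mul]
      calc _ ≤ ∑' k, D e k * potential l r U z ε b X s := by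
            refine ENNReal.tsum_le_tsum fun k => ?_
            by_cases hk : D e k = 0
            · simp [hk]
            · exact mul_le_mul_right (hmono k hk) _
        _ = _ := by rw [ENNReal.tsum_mul_right, (D e).tsum_coe, one_mul]

/-- A fixed witness is unlikely to survive many rounds. -/
theorem weightLaw_witness_le (hlr : ∀ e f, l e ≠ r f) (hz : ∀ x ∉ U, z x = 0)
    (hX : 2 * X ≤ 1) (hp0 : 0 ≤ p) (hp1 : p ≤ 1) (hε : 0 ≤ ε) (K m : ℕ)
    (hm : ((m : ℝ) - 1) * K < ε * b) :
    ∀ (n : ℕ) (s : Knowledge E) (D : E → PMF ℕ), Compatible s.lo s.hi p D → (∀ e, s.hi e ≤ K) →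
      X ^ b * weightLaw D {c | Witness l r U z ε b (knowledgeAfter l r n s c)} ≤
        ENNReal.ofReal (1 - p / 2) ^ (m * n) * potential l r U z ε b X s := by
  classical
  have hX1 : X ≤ 1 := by
    refine le_trans ?_ hX
    rw [two_mul]
    exact le_self_add
  intro n
  induction n with
  | zero =>
    intro s D _ _
    simp only [knowledgeAfter, mul_zero, pow_zero, one_mul]
    unfold potential
    split_ifs with h
    · have hle : ∑ x, coverExt l r U z s.lo x ≤ b := by
        have h2 : ((∑ x, coverExt l r U z s.lo x : ℕ) : ℝ) ≤ b := by
          have hb : (0 : ℝ) ≤ b := Nat.cast_nonneg b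
          nlinarith [h.2.1]
        exact_mod_cast h2
      calc _ ≤ X ^ b * 1 := mul_le_mul_right prob_le_one _
        _ = X ^ b := mul_one _
        _ ≤ _ := pow_le_pow_right_of_le_one' hX1 hle
    · simp [h]
  | succ n ih =>
    intro s D hD hK
    obtain ⟨hl, hr⟩ := maxMatching_endpointInjective l r s.hi
    have h := weightLaw_observe_le (ε := ε) (b := b) hlr hz hX hp0 hp1 K _ _ ih
      (maxMatching l r s.hi).toList (by
        refine List.Pairwise.imp_of_mem ?_ (Finset.nodup_toList _)
        intro e f he hf hne
        rw [Finset.mem_toList] at he hf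
        exact ⟨fun h => hne (hl hf he h).symm, fun h => hne (hr hf he h).symm⟩) s D hD hK
    refine h.trans ?_
    by_cases hw : Witness l r U z ε b s
    swap
    · simp [potential, hw]
    rw [countP_toList, ← mul_assoc, ← pow_add]
    refine mul_le_mul_left (pow_le_pow_right_of_le_one' ?_ ?_) _
    · rw [ENNReal.ofReal_le_one]
      linarith
    · rw [mul_add, mul_one]
      exact Nat.add_le_add_left (hw.le_card_slack hlr hK hm) _

end Survival

/-- The number of vectors on `U` weighted by their totals. -/
theorem sum_pow_sum_le {V : Type*} [Fintype V] [DecidableEq V] (U : Finset V) (B : ℕ) (x : ℝ)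
    (hx0 : 0 ≤ x) (hx : x ≤ 1 / 2) :
    ∑ z ∈ Fintype.piFinset (fun v => if v ∈ U then Finset.range B else {0}), x ^ ∑ v, z v ≤
      Real.exp (2 * x * U.card) := by
  simp_rw [← Finset.prod_pow_eq_pow_sum]
  -- The sum factorises over vertices; each factor on `U` is a truncated geometric series.
  rw [← Finset.prod_univ_sum (fun v => if v ∈ U then Finset.range B else {0}) fun _ k => x ^ k]
  calc _ ≤ ∏ v, (if v ∈ U then Real.exp (2 * x) else 1) := by
        refine Finset.prod_le_prod (fun v _ => Finset.sum_nonneg fun k _ => by positivity)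
          fun v _ => ?_
        split_ifs
        · calc ∑ k ∈ Finset.range B, x ^ k ≤ ∑' k, x ^ k :=
                (summable_geometric_of_lt_one hx0 (by linarith)).sum_le_tsum _
                  fun k _ => by positivity
            _ = (1 - x)⁻¹ := tsum_geometric_of_lt_one hx0 (by linarith)
            _ ≤ 1 + 2 * x := by
                rw [inv_le_iff_one_le_mul₀ (by linarith)]
                nlinarith
            _ ≤ _ := by linarith [Real.add_one_le_exp (2 * x)]
        · simp
    _ = _ := by
        rw [Finset.prod_ite_mem, Finset.univ_inter, Finset.prod_const, ← Real.exp_nat_mul]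
        ring_nf

/-! ### Union bound and failure probability -/

section Failure

variable {E V : Type*} [Fintype E] [Fintype V] {l r : E → V}

/-- If the lower bounds do not yet support a good matching, this is certified by a witness. -/
theorem exists_witness (hlr : ∀ e f, l e ≠ r f) {U : Set V} {s : Knowledge E} {ε : ℝ}
    (hε0 : 0 ≤ ε) (hU : ∀ e, s.lo e ≠ 0 → l e ∈ U ∨ r e ∈ U)
    (h : (maxWeight l r s.lo : ℝ) < (1 - ε) * maxWeight l r s.hi) :
    ∃ z : V → ℕ, (∀ x ∉ U, z x = 0) ∧ (∀ x, z x ≤ maxWeight l r s.hi) ∧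
      Witness l r U z ε (maxWeight l r s.hi) s := by
  classical
  obtain ⟨y, hy, hsum⟩ := exists_cover_le_maxWeight hlr s.lo
  have hyb : ∀ x, y x ≤ maxWeight l r s.hi := by
    intro x
    have h1 : y x ≤ maxWeight l r s.lo :=
      (Finset.single_le_sum (fun _ _ => Nat.zero_le _) (Finset.mem_univ x)).trans hsum
    refine h1.trans ?_
    have h2 : (maxWeight l r s.lo : ℝ) ≤ maxWeight l r s.hi := by
      have : (0 : ℝ) ≤ maxWeight l r s.hi := Nat.cast_nonneg _
      nlinarith
    exact_mod_cast h2
  -- Truncating `y` to `U` loses nothing: by minimality the extension stays below `y`.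
  refine ⟨fun x => if x ∈ U then y x else 0, fun x hx => if_neg hx, fun x => ?_, ?_, ?_, le_rfl⟩
  · dsimp only
    split_ifs
    · exact hyb x
    · exact Nat.zero_le _
  · intro e he
    by_cases hl : l e ∈ U
    · simpa [hl, he.1 hl] using hy e
    · have hr : r e ∉ U := fun hr => hl (he.2 hr)
      have : s.lo e = 0 := by
        by_contra h0
        exact (hU e h0).elim hl hr
      simp [this]
  · refine lt_of_le_of_lt ?_ h
    have := Finset.sum_le_sum fun x (_ : x ∈ Finset.univ) =>
      coverExt_le l r U (fun x => if x ∈ U then y x else 0) s.lo y hy hU (fun x hx => if_pos hx) x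
    exact_mod_cast this.trans hsum

/-- The three terms in `hT` pay for the floor `x ^ b`, for the weighted count `exp (2 * x * u) ≤ exp
(2 * b)` of witnesses, and for the target `(ε / 4) ^ b`, which is summable over `b`. -/
theorem rounds_decay_le {K m T b : ℕ} {p ε x u : ℝ} (hK : 1 ≤ K) (hp0 : 0 < p) (hp1 : p ≤ 1)
    (hε0 : 0 < ε) (hx0 : 0 < x) (hT : 2 * K / (p * ε) * (Real.log (1 / x) + 2 + Real.log (4 / ε)) ≤ T)
    (hm : ε * b ≤ m * K) (hu : x * u ≤ b) :
    (1 - p / 2) ^ (m * T) * Real.exp (2 * x * u) ≤ x ^ b * (ε / 4) ^ b := by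
  have hK0 : (0 : ℝ) < K := by exact_mod_cast hK
  have hT0 : (0 : ℝ) ≤ T := Nat.cast_nonneg _
  have h1 : (1 - p / 2) ^ (m * T) ≤ Real.exp (-(p / 2) * (m * T : ℕ)) := by
    rw [mul_comm (-(p / 2)), Real.exp_nat_mul]
    refine pow_le_pow_left₀ (by linarith) ?_ _
    linarith [Real.add_one_le_exp (-(p / 2))]
  have h2 : x ^ b * (ε / 4) ^ b = Real.exp (b * (-Real.log (1 / x) - Real.log (4 / ε))) := by
    rw [← mul_pow, Real.exp_nat_mul, Real.exp_sub, Real.exp_neg, Real.exp_log (by positivity),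
      Real.exp_log (by positivity)]
    congr 1
    field_simp
  rw [h2]
  refine (mul_le_mul_of_nonneg_right h1 (Real.exp_pos _).le).trans ?_
  rw [← Real.exp_add]
  refine Real.exp_le_exp.2 ?_
  have h3 : b * (Real.log (1 / x) + 2 + Real.log (4 / ε)) ≤ p / 2 * (m * T : ℕ) := by
    have h4 : Real.log (1 / x) + 2 + Real.log (4 / ε) ≤ p * ε * T / (2 * K) := by
      rw [le_div_iff₀ (by positivity)]
      have := mul_le_mul_of_nonneg_left hT (by positivity : 0 ≤ p * ε)
      have h5 : p * ε * (2 * K / (p * ε) * (Real.log (1 / x) + 2 + Real.log (4 / ε))) =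
        (Real.log (1 / x) + 2 + Real.log (4 / ε)) * (2 * K) := by field_simp
      linarith
    calc (b : ℝ) * (Real.log (1 / x) + 2 + Real.log (4 / ε)) ≤ b * (p * ε * T / (2 * K)) := by gcongr
      _ = p * T / (2 * K) * (ε * b) := by ring
      _ ≤ p * T / (2 * K) * (m * K) := by gcongr
      _ = p / 2 * (m * T : ℕ) := by push_cast; field_simp
  linarith

theorem weightLaw_exists_witness_le (hlr : ∀ e f, l e ≠ r f) {lo hi : E → ℕ} {p ε x : ℝ}
    {K T b : ℕ} {D : E → PMF ℕ} (hD : Compatible lo hi p D) (hhi : ∀ e, hi e ≤ K) (hK : 1 ≤ K)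
    (hp0 : 0 < p) (hp1 : p ≤ 1) (hε0 : 0 < ε) (hx0 : 0 < x) (hx : x ≤ 1 / 2)
    (hT : 2 * K / (p * ε) * (Real.log (1 / x) + 2 + Real.log (4 / ε)) ≤ T)
    (U : Finset V) (hb : x * U.card ≤ b) (hb1 : 1 ≤ b) :
    weightLaw D {c | ∃ z : V → ℕ, (∀ v ∉ U, z v = 0) ∧ (∀ v, z v ≤ b) ∧
      Witness l r U z ε b (knowledgeAfter l r T ⟨lo, hi⟩ c)} ≤ ENNReal.ofReal ((ε / 4) ^ b) := by
  classical
  set Z : Finset (V → ℕ) := Fintype.piFinset (fun v => if v ∈ U then Finset.range (b + 1) else {0})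
    with hZ
  -- Rounding up serves both uses: `hm1` drives the decay, `hm2` guarantees `m` slack edges per
  -- round.
  set m : ℕ := ⌈ε * b / K⌉₊ with hm
  have hK0 : (0 : ℝ) < K := by exact_mod_cast hK
  have hm1 : ε * b ≤ m * K := by
    rw [← div_le_iff₀ hK0]
    exact Nat.le_ceil _
  have hm2 : ((m : ℝ) - 1) * K < ε * b := by
    rw [← lt_div_iff₀ hK0]
    have := Nat.ceil_lt_add_one (a := ε * b / K) (by positivity)
    linarith
  set X := ENNReal.ofReal x with hX
  have hX2 : 2 * X ≤ 1 := by
    rw [hX, ← ENNReal.ofReal_ofNat 2, ← ENNReal.ofReal_mul two_pos.le, ENNReal.ofReal_le_one]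
    linarith
  have hX1 : X ≤ 1 := by
    rw [hX, ENNReal.ofReal_le_one]
    linarith
  have hsub : {c | ∃ z : V → ℕ, (∀ v ∉ U, z v = 0) ∧ (∀ v, z v ≤ b) ∧
      Witness l r U z ε b (knowledgeAfter l r T ⟨lo, hi⟩ c)} ⊆
      ⋃ z ∈ Z, {c | Witness l r U z ε b (knowledgeAfter l r T ⟨lo, hi⟩ c)} := by
    rintro c ⟨z, hz0, hzb, hz⟩
    refine Set.mem_biUnion (x := z) ?_ hz
    refine Fintype.mem_piFinset.2 fun v => ?_
    by_cases hv : v ∈ U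
    · simpa [hv, Nat.lt_succ_iff] using hzb v
    · simpa [hv] using hz0 v hv
  have hz : ∀ z ∈ Z, X ^ b * weightLaw D {c | Witness l r U z ε b (knowledgeAfter l r T ⟨lo, hi⟩ c)} ≤
      ENNReal.ofReal ((1 - p / 2) ^ (m * T) * x ^ ∑ v, z v) := by
    intro z hz
    have hz0 : ∀ v ∉ (U : Set V), z v = 0 := by
      intro v hv
      have := Fintype.mem_piFinset.1 hz v
      rw [Finset.mem_coe] at hv
      simpa [hv] using this
    refine (weightLaw_witness_le hlr hz0 hX2 hp0.le hp1 hε0.le K m hm2 T ⟨lo, hi⟩ D hD hhi).trans ?_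
    rw [ENNReal.ofReal_mul (pow_nonneg (by linarith) _), ENNReal.ofReal_pow (by linarith),
      ENNReal.ofReal_pow hx0.le]
    refine mul_le_mul_right ?_ _
    unfold potential
    split_ifs
    · exact pow_le_pow_right_of_le_one' hX1 (Finset.sum_le_sum fun v _ => le_coverExt l r U z hz0 _ v)
    · exact zero_le
  have hXb0 : X ^ b ≠ 0 := pow_ne_zero _ (by simpa [hX] using hx0)
  have hXbt : X ^ b ≠ ⊤ := ENNReal.pow_ne_top ENNReal.ofReal_ne_top
  refine (measure_mono hsub).trans ((measure_biUnion_finset_le _ _).trans ?_)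
  rw [← ENNReal.mul_le_mul_iff_right hXb0 hXbt, Finset.mul_sum]
  refine (Finset.sum_le_sum hz).trans ?_
  rw [← ENNReal.ofReal_sum_of_nonneg (fun z _ => mul_nonneg (pow_nonneg (by linarith) _)
    (pow_nonneg hx0.le _)), ← Finset.mul_sum, hX, ← ENNReal.ofReal_pow hx0.le,
    ← ENNReal.ofReal_mul (pow_nonneg hx0.le _)]
  refine ENNReal.ofReal_le_ofReal ?_
  refine le_trans ?_ (rounds_decay_le hK hp0 hp1 hε0 hx0 hT hm1 hb)
  exact mul_le_mul_of_nonneg_left (sum_pow_sum_le U (b + 1) x hx0.le hx) (pow_nonneg (by linarith) _)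

omit [Fintype V] in
/-- The upper bounds of a maximum matching are spread over many edges. -/
theorem maxWeight_le_card_mul {hi : E → ℕ} {K : ℕ} (hhi : ∀ e, hi e ≤ K) :
    maxWeight l r hi ≤ ((maxMatching l r hi).filter fun e => 1 ≤ hi e).card * K := by
  rw [maxWeight, ← smul_eq_mul, ← Finset.sum_const, Finset.sum_filter]
  refine Finset.sum_le_sum fun e _ => ?_
  split_ifs with h
  · exact hhi e
  · omega

theorem two_rpow_le_exp {a : ℝ} (ha : 0 ≤ a) : (2 : ℝ) ^ a ≤ Real.exp a := by
  rw [← Real.exp_one_rpow]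
  exact Real.rpow_le_rpow two_pos.le (by linarith [Real.add_one_le_exp 1]) ha

omit [Fintype V] in
-- With `N` positive edges in the matching, the `8` in `x` keeps the tilt below `ε * p * N / 8`,
-- well under the decay `p * N / 2`; `hlarge` then forces `p * N ≥ 8 / ε`.
theorem weightLaw_few_realized_le {lo hi : E → ℕ} {p ε x : ℝ} {K : ℕ} {D : E → PMF ℕ}
    (hD : Compatible lo hi p D) (hhi : ∀ e, hi e ≤ K) (hK : 1 ≤ K) (hp0 : 0 < p) (hp1 : p ≤ 1)
    (hε0 : 0 < ε) (hε1 : ε < 1) (hx : x = ε * p / (8 * K)) (hlarge : 1 < x * maxWeight l r hi) :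
    weightLaw D {c | ((∑ e ∈ maxMatching l r hi, c e : ℕ) : ℝ) < x * maxWeight l r hi} ≤
      ENNReal.ofReal (ε / 2) := by
  classical
  refine (weightLaw_sum_lt_le hp0.le hp1 (fun e => (hD e).2) _ _ _ le_rfl).trans ?_
  refine ENNReal.ofReal_le_ofReal ?_
  set N := ((maxMatching l r hi).filter fun e => 1 ≤ hi e).card with hN
  have hμ : (maxWeight l r hi : ℝ) ≤ N * K := by
    exact_mod_cast maxWeight_le_card_mul (l := l) (r := r) hhi
  have hK0 : (0 : ℝ) < K := by exact_mod_cast hK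
  have hx0 : 0 < x := by rw [hx]; positivity
  have h1 : (1 - p / 2) ^ N ≤ Real.exp (N * -(p / 2)) := by
    rw [Real.exp_nat_mul]
    refine pow_le_pow_left₀ (by linarith) ?_ _
    linarith [Real.add_one_le_exp (-(p / 2))]
  have h2 := two_rpow_le_exp (a := x * maxWeight l r hi) (by linarith)
  calc _ ≤ Real.exp (x * maxWeight l r hi) * Real.exp (N * -(p / 2)) :=
        mul_le_mul h2 h1 (pow_nonneg (by linarith) _) (Real.exp_pos _).le
    _ = Real.exp (x * maxWeight l r hi + N * -(p / 2)) := (Real.exp_add _ _).symm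
    _ ≤ Real.exp (-(2 / ε)) := by
        refine Real.exp_le_exp.2 ?_
        have h3 : x * (8 * K) = ε * p := by rw [hx]; field_simp
        have h4 : x * maxWeight l r hi ≤ ε * (p / 8) * N := by
          calc x * maxWeight l r hi ≤ x * (N * K) := by gcongr
            _ = x * (8 * K) * N / 8 := by ring
            _ = _ := by rw [h3]; ring
        have hpN : 0 ≤ p * N := by positivity
        have h5 : 8 ≤ ε * (p * N) := by linarith
        have h6 : ε * (p * N) ≤ p * N := by nlinarith
        have h7 : 2 / ε ≤ p * N / 4 := by
          rw [div_le_iff₀ hε0]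
          linarith
        linarith
    _ ≤ ε / 2 := by
        rw [Real.exp_neg, inv_le_comm₀ (Real.exp_pos _) (by positivity), inv_div]
        linarith [Real.add_one_le_exp (2 / ε)]

theorem weightLaw_rounds_fail_le (hlr : ∀ e f, l e ≠ r f) {lo hi : E → ℕ} {p ε : ℝ}
    {K T : ℕ} {D : E → PMF ℕ} (hD : Compatible lo hi p D) (hhi : ∀ e, hi e ≤ K) (hK : 1 ≤ K)
    (hp0 : 0 < p) (hp1 : p ≤ 1) (hε0 : 0 < ε) (hε1 : ε < 1)
    (hT : 2 * K / (p * ε) * (Real.log (1 / (ε * p / (8 * K))) + 2 + Real.log (4 / ε)) ≤ T) :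
    weightLaw D {c | ¬ ∀ N : Finset E, EndpointInjective l r N →
      (1 - ε) * ((∑ e ∈ N, c e : ℕ) : ℝ) ≤
        ((∑ e ∈ maxMatching l r (knowledgeAfter l r T ⟨lo, hi⟩ c).lo, c e : ℕ) : ℝ)} ≤
      ENNReal.ofReal ε := by
  classical
  set x := ε * p / (8 * K) with hx
  have hK1 : (1 : ℝ) ≤ K := by exact_mod_cast hK
  have hx0 : 0 < x := by positivity
  have hx2 : x ≤ 1 / 2 := by
    rw [hx, div_le_iff₀ (by positivity)]
    nlinarith
  obtain ⟨y, hy, hysum⟩ := exists_cover_le_maxWeight hlr hi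
  set μ := maxWeight l r hi with hμ
  -- Integrality of the cover bounds its support by its total.
  set U : Finset V := Finset.univ.filter fun v => y v ≠ 0 with hU
  have hUcard : U.card ≤ μ := by
    refine le_trans ?_ hysum
    rw [Finset.card_filter]
    refine Finset.sum_le_sum fun v _ => ?_
    split_ifs <;> omega
  set A : Set (E → ℕ) := {c | 1 < x * μ ∧ ((∑ e ∈ maxMatching l r hi, c e : ℕ) : ℝ) < x * μ}
  set B : ℕ → Set (E → ℕ) := fun b => {c | ∃ z : V → ℕ, (∀ v ∉ U, z v = 0) ∧ (∀ v, z v ≤ b) ∧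
      Witness l r U z ε b (knowledgeAfter l r T ⟨lo, hi⟩ c)}
  set I : Finset ℕ := (Finset.Icc 1 μ).filter fun b => x * μ ≤ b with hI
  have hA : weightLaw D A ≤ ENNReal.ofReal (ε / 2) := by
    by_cases h : 1 < x * μ
    · refine (measure_mono fun c hc => hc.2).trans
        (weightLaw_few_realized_le (l := l) (r := r) hD hhi hK hp0 hp1 hε0 hε1 hx h)
    · have : A = ∅ := Set.eq_empty_of_forall_notMem fun c hc => h hc.1
      simp [this]
  have hB : weightLaw D (⋃ b ∈ I, B b) ≤ ENNReal.ofReal (ε / 2) := by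
    refine (measure_biUnion_finset_le _ _).trans ?_
    calc ∑ b ∈ I, weightLaw D (B b) ≤ ∑ b ∈ I, ENNReal.ofReal ((ε / 4) ^ b) := by
          refine Finset.sum_le_sum fun b hb => ?_
          rw [hI, Finset.mem_filter, Finset.mem_Icc] at hb
          refine weightLaw_exists_witness_le hlr hD hhi hK hp0 hp1 hε0 hx0 hx2 hT U ?_ hb.1.1
          refine le_trans ?_ hb.2
          gcongr
      _ = ENNReal.ofReal (∑ b ∈ I, (ε / 4) ^ b) :=
          (ENNReal.ofReal_sum_of_nonneg fun b _ => by positivity).symm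
      _ ≤ ENNReal.ofReal (ε / 2) := by
          refine ENNReal.ofReal_le_ofReal ?_
          have h0 : 0 ∉ I := by simp [hI]
          have h1 := (summable_geometric_of_lt_one (r := ε / 4) (by positivity)
            (by linarith)).sum_le_tsum (insert 0 I) fun k _ => by positivity
          rw [Finset.sum_insert h0, pow_zero,
            tsum_geometric_of_lt_one (by positivity) (by linarith)] at h1
          have h2 : (1 - ε / 4)⁻¹ ≤ 1 + ε / 2 := by
            rw [inv_le_iff_one_le_mul₀ (by linarith)]
            nlinarith
          linarith
  have hae : ∀ᵐ c ∂weightLaw D, ∀ e, lo e ≤ c e ∧ c e ≤ hi e := by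
    filter_upwards [ae_mem_support D] with c hc e using (hD e).1 _ (hc e)
  have hsub : {c | ¬ ∀ N : Finset E, EndpointInjective l r N →
      (1 - ε) * ((∑ e ∈ N, c e : ℕ) : ℝ) ≤
        ((∑ e ∈ maxMatching l r (knowledgeAfter l r T ⟨lo, hi⟩ c).lo, c e : ℕ) : ℝ)} ≤ᵐ[weightLaw D]
      (A ∪ ⋃ b ∈ I, B b : Set (E → ℕ)) := by
    filter_upwards [hae] with c hc hfail
    have hbd := knowledgeAfter_bounds l r c T ⟨lo, hi⟩ hc
    set s := knowledgeAfter l r T ⟨lo, hi⟩ c with hs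
    have hfail' : ¬ ∀ N : Finset E, EndpointInjective l r N →
      (1 - ε) * ((∑ e ∈ N, c e : ℕ) : ℝ) ≤ ((∑ e ∈ maxMatching l r s.lo, c e : ℕ) : ℝ) := hfail
    push Not at hfail'
    obtain ⟨N, hN, hlt⟩ := hfail'
    have h1 : (maxWeight l r s.lo : ℝ) ≤ ((∑ e ∈ maxMatching l r s.lo, c e : ℕ) : ℝ) := by
      exact_mod_cast Finset.sum_le_sum fun e _ => (hbd e).2.1
    have h2 : ((∑ e ∈ N, c e : ℕ) : ℝ) ≤ maxWeight l r s.hi := by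
      exact_mod_cast (Finset.sum_le_sum fun e _ => (hbd e).2.2.1).trans (hN.sum_le_maxWeight s.hi)
    have h3 : (maxWeight l r s.lo : ℝ) < (1 - ε) * maxWeight l r s.hi := by
      have := mul_le_mul_of_nonneg_left h2 (by linarith : 0 ≤ 1 - ε)
      linarith
    have h4 : maxWeight l r s.hi ≤ μ := maxWeight_mono l r fun e => (hbd e).2.2.2
    have h5 : 1 ≤ maxWeight l r s.hi := by
      by_contra h0
      have h0 : maxWeight l r s.hi = 0 := by omega
      rw [h0, Nat.cast_zero, mul_zero] at h3
      exact absurd h3 (not_lt.2 (Nat.cast_nonneg _))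
    have h6 : ∑ e ∈ maxMatching l r hi, c e ≤ maxWeight l r s.hi :=
      (Finset.sum_le_sum fun e _ => (hbd e).2.2.1).trans
        ((maxMatching_endpointInjective l r hi).sum_le_maxWeight s.hi)
    -- A large final optimum is left to the union bound. A small one bounds the realized weight of
    -- the initial optimistic matching; being at least `1`, it also forces `1 < x * μ`.
    by_cases hlow : x * μ ≤ maxWeight l r s.hi
    · right
      refine Set.mem_biUnion (x := maxWeight l r s.hi)
        (by simp only [hI, Finset.coe_filter, Finset.mem_Icc]; exact ⟨⟨h5, h4⟩, hlow⟩) ?_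
      refine exists_witness hlr (U := (U : Set V)) hε0.le (fun e he => ?_) h3
      have h7 := hy e
      have h8 := hbd e
      have h9 : hi e ≠ 0 := by
        have : s.hi e ≤ hi e := h8.2.2.2
        omega
      simp only [hU, Finset.coe_filter, Finset.mem_univ, true_and, Set.mem_ofPred_eq]
      omega
    · left
      push Not at hlow
      have h7 : (1 : ℝ) ≤ maxWeight l r s.hi := by exact_mod_cast h5
      have h8 : ((∑ e ∈ maxMatching l r hi, c e : ℕ) : ℝ) ≤ maxWeight l r s.hi := by
        exact_mod_cast h6
      exact ⟨by linarith, by linarith⟩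
  refine (measure_mono_ae hsub).trans ((measure_union_le _ _).trans ((add_le_add hA hB).trans ?_))
  rw [← ENNReal.ofReal_add (by positivity) (by positivity), add_halves]

omit [Fintype V] in
-- Per positive edge, the tilt costs at most `4 / 3` and the moment gains `11 / 20`. The product `11
-- / 15` is below `3 / 4 ≤ ε`.
theorem weightLaw_no_query_fail_le {lo hi : E → ℕ} {p ε : ℝ} {K : ℕ} {D : E → PMF ℕ}
    (hD : Compatible lo hi p D) (hhi : ∀ e, hi e ≤ K) (hK : 1 ≤ K) (hp : 9 / 10 ≤ p) (hp1 : p ≤ 1)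
    (hε : 1 - 1 / (4 * K) ≤ ε) (hε1 : ε < 1) :
    weightLaw D {c | ¬ ∀ N : Finset E, EndpointInjective l r N →
      (1 - ε) * ((∑ e ∈ N, c e : ℕ) : ℝ) ≤ ((∑ e ∈ maxMatching l r hi, c e : ℕ) : ℝ)} ≤
      ENNReal.ofReal ε := by
  classical
  have hae : ∀ᵐ c ∂weightLaw D, ∀ e, c e ≤ hi e := by
    filter_upwards [ae_mem_support D] with c hc e using ((hD e).1 _ (hc e)).2
  set μ := maxWeight l r hi with hμ
  have hsub : {c | ¬ ∀ N : Finset E, EndpointInjective l r N →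
      (1 - ε) * ((∑ e ∈ N, c e : ℕ) : ℝ) ≤ ((∑ e ∈ maxMatching l r hi, c e : ℕ) : ℝ)}
      ≤ᵐ[weightLaw D] {c | ((∑ e ∈ maxMatching l r hi, c e : ℕ) : ℝ) < (1 - ε) * μ} := by
    filter_upwards [hae] with c hc hfail
    have hfail' : ¬ ∀ N : Finset E, EndpointInjective l r N →
      (1 - ε) * ((∑ e ∈ N, c e : ℕ) : ℝ) ≤ ((∑ e ∈ maxMatching l r hi, c e : ℕ) : ℝ) := hfail
    push Not at hfail'
    obtain ⟨N, hN, hlt⟩ := hfail'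
    have h2 : ((∑ e ∈ N, c e : ℕ) : ℝ) ≤ μ := by
      exact_mod_cast (Finset.sum_le_sum fun e _ => hc e).trans (hN.sum_le_maxWeight hi)
    have := mul_le_mul_of_nonneg_left h2 (by linarith : 0 ≤ 1 - ε)
    exact lt_of_lt_of_le hlt this
  refine (measure_mono_ae hsub).trans ?_
  rcases Nat.eq_zero_or_pos μ with h0 | hpos
  · have : {c : E → ℕ | ((∑ e ∈ maxMatching l r hi, c e : ℕ) : ℝ) < (1 - ε) * μ} = ∅ := by
      refine Set.eq_empty_of_forall_notMem fun c hc => ?_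
      have hc' : ((∑ e ∈ maxMatching l r hi, c e : ℕ) : ℝ) < (1 - ε) * μ := hc
      rw [h0, Nat.cast_zero, mul_zero] at hc'
      exact absurd hc' (not_lt.2 (Nat.cast_nonneg _))
    rw [this, measure_empty]
    exact zero_le
  refine (weightLaw_sum_lt_le (by linarith) hp1 (fun e => (hD e).2) _ _ _ le_rfl).trans ?_
  refine ENNReal.ofReal_le_ofReal ?_
  set N := ((maxMatching l r hi).filter fun e => 1 ≤ hi e).card with hN
  have hμN : μ ≤ N * K := maxWeight_le_card_mul hhi
  have hN1 : N ≠ 0 := by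
    intro h
    rw [h] at hμN
    omega
  have hμN' : (μ : ℝ) ≤ N * K := by exact_mod_cast hμN
  have hK0 : (1 : ℝ) ≤ K := by exact_mod_cast hK
  have hε4 : 3 / 4 ≤ ε := by
    refine le_trans ?_ hε
    have : 1 / (4 * (K : ℝ)) ≤ 1 / 4 := by
      rw [div_le_div_iff₀ (by positivity) (by norm_num)]
      linarith
    linarith
  have h1 : (1 - ε) * μ ≤ N * (1 / 4) := by
    calc (1 - ε) * μ ≤ 1 / (4 * K) * (N * K) := by
          gcongr
          linarith
      _ = _ := by field_simp
  have h2 : (2 : ℝ) ^ ((1 - ε) * μ) ≤ (4 / 3) ^ N := by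
    refine (two_rpow_le_exp (mul_nonneg (by linarith) (Nat.cast_nonneg _))).trans ?_
    refine (Real.exp_le_exp.2 h1).trans ?_
    rw [Real.exp_nat_mul]
    refine pow_le_pow_left₀ (Real.exp_pos _).le ?_ _
    have h3 := Real.add_one_le_exp (-(1 / 4) : ℝ)
    rw [Real.exp_neg, le_inv_comm₀ (by norm_num) (Real.exp_pos _)] at h3
    exact h3.trans (by norm_num)
  calc _ ≤ (4 / 3 : ℝ) ^ N * (11 / 20) ^ N := by
        refine mul_le_mul h2 ?_ (pow_nonneg (by linarith) _) (by positivity)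
        exact pow_le_pow_left₀ (by linarith) (by linarith) _
    _ = (11 / 15) ^ N := by rw [← mul_pow]; norm_num
    _ ≤ 11 / 15 := pow_le_of_le_one (by norm_num) (by norm_num) hN1
    _ ≤ ε := by linarith

end Failure
-- Translation to graphs, the constant, and assembly
theorem exists_endpoints {V : Type*} {G : SimpleGraph V} (hG : G.IsBipartite) :
    ∃ l r : G.edgeSet → V, (∀ e f, l e ≠ r f) ∧ ∀ e x, x ∈ e.1 ↔ x = l e ∨ x = r e := by
  obtain ⟨col⟩ := hG
  have h : ∀ e : G.edgeSet, ∃ a b : V, col a = 0 ∧ col b = 1 ∧ e.1 = s(a, b) := by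
    rintro ⟨e, he⟩
    induction e using Sym2.ind with
    | _ a b =>
      have hne : col a ≠ col b := col.valid he
      rcases Fin.exists_fin_two.1 ⟨col a, rfl⟩ with ha | ha <;>
        rcases Fin.exists_fin_two.1 ⟨col b, rfl⟩ with hb | hb
      · exact absurd (ha.trans hb.symm) hne
      · exact ⟨a, b, ha, hb, rfl⟩
      · exact ⟨b, a, hb, ha, Sym2.eq_swap⟩
      · exact absurd (ha.trans hb.symm) hne
  choose l r hl hr he using h
  refine ⟨l, r, fun e f h => ?_, fun e x => ?_⟩
  · have := (hl e).symm.trans ((congrArg col h).trans (hr f))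
    exact absurd this (by decide)
  · rw [he e, Sym2.mem_iff]

theorem isMatching_iff {V : Type*} {G : SimpleGraph V} {l r : G.edgeSet → V}
    (hlr : ∀ e f, l e ≠ r f) (hmem : ∀ e x, x ∈ e.1 ↔ x = l e ∨ x = r e) (M : Finset G.edgeSet) :
    IsMatching M ↔ EndpointInjective l r M := by
  constructor
  · intro h
    refine ⟨fun e he f hf hef => ?_, fun e he f hf hef => ?_⟩
    · exact h (l e) e he f hf ((hmem _ _).2 (.inl rfl)) ((hmem _ _).2 (.inl hef))
    · exact h (r e) e he f hf ((hmem _ _).2 (.inr rfl)) ((hmem _ _).2 (.inr hef))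
  · rintro ⟨hl, hr⟩ u e he f hf hue huf
    rcases (hmem _ _).1 hue with h1 | h1 <;> rcases (hmem _ _).1 huf with h2 | h2
    · exact hl he hf (h1.symm.trans h2)
    · exact absurd (h1.symm.trans h2) (hlr _ _)
    · exact absurd (h2.symm.trans h1) (hlr _ _)
    · exact hr he hf (h1.symm.trans h2)

theorem le_successProb_pure {E : Type*} [Fintype E] (t : QueryTree E) (D : E → PMF ℕ)
    (good : (E → ℕ) → Finset E → Prop) {ε : ℝ} (hε : 0 ≤ ε)
    (h : weightLaw D {c | ¬ good c (t.result c)} ≤ ENNReal.ofReal ε) :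
    ENNReal.ofReal (1 - ε) ≤ successProb (PMF.pure t) D good := by
  classical
  rw [successProb, tsum_eq_single t fun t' ht' => by simp [ht']]
  rw [PMF.pure_apply_self, one_mul, ENNReal.ofReal_sub _ hε, ENNReal.ofReal_one,
    tsub_le_iff_right, ← prob_add_prob_compl (μ := weightLaw D) (s := {c | good c (t.result c)})
      MeasurableSet.of_discrete]
  exact add_le_add le_rfl h

/-- Outside the no-query corner `ε * p ≤ 1 - 1 / (10 * k)`, so the logarithm is at least `1 / (10 *
k)` and absorbs all additive constants, including the `1` lost to the ceiling. -/
theorem rounds_le {k : ℕ} (hk : 1 ≤ k) {p ε : ℝ} (hp0 : 0 < p) (hp1 : p ≤ 1) (hε0 : 0 < ε)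
    (hε1 : ε < 1) (h : ¬ (9 / 10 ≤ p ∧ 1 - 1 / (4 * (k : ℝ)) ≤ ε)) :
    (⌈2 * k / (p * ε) * (Real.log (1 / (ε * p / (8 * k))) + 2 + Real.log (4 / ε))⌉₊ : ℝ) ≤
      (2 * k * (10 * k * (8 * k + 5) + 2) + 10 * k) * (Real.log (1 / (ε * p)) / (ε * p)) := by
  have hk1 : (1 : ℝ) ≤ k := by exact_mod_cast hk
  set δ := ε * p with hδ
  have hδ0 : 0 < δ := by positivity
  have hδ1 : δ ≤ 1 := by nlinarith
  have hδε : δ ≤ ε := by nlinarith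
  have hinv : 1 / (10 * (k : ℝ)) ≤ 1 / 10 := by
    rw [div_le_div_iff₀ (by positivity) (by norm_num)]
    linarith
  have hδk : δ ≤ 1 - 1 / (10 * k) := by
    by_cases hp : 9 / 10 ≤ p
    · have h1 : ε < 1 - 1 / (4 * (k : ℝ)) := by
        by_contra! h2
        exact h ⟨hp, h2⟩
      have h2 : 1 / (10 * (k : ℝ)) ≤ 1 / (4 * k) := by
        gcongr
        norm_num
      linarith
    · push Not at hp
      nlinarith
  set Λ := Real.log (1 / δ) with hΛ
  have hΛ1 : 1 / (10 * k) ≤ Λ := by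
    rw [hΛ, one_div δ, Real.log_inv]
    linarith [Real.log_le_sub_one_of_pos hδ0]
  have hΛk : 1 ≤ 10 * k * Λ := by
    rw [div_le_iff₀ (by positivity)] at hΛ1
    linarith
  have hlog1 : Real.log (1 / (δ / (8 * k))) ≤ 8 * k - 1 + Λ := by
    have : 1 / (δ / (8 * k)) = 8 * k * (1 / δ) := by field_simp
    rw [this, Real.log_mul (by positivity) (by positivity)]
    linarith [Real.log_le_sub_one_of_pos (show (0 : ℝ) < 8 * k by positivity)]
  have hlog2 : Real.log (4 / ε) ≤ 3 + Λ := by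
    have h4 : 4 / ε ≤ 4 * (1 / δ) := by
      rw [mul_one_div]
      gcongr
    refine (Real.log_le_log (by positivity) h4).trans ?_
    rw [Real.log_mul (by norm_num) (by positivity)]
    linarith [Real.log_le_sub_one_of_pos (show (0 : ℝ) < 4 by norm_num)]
  have hlog20 : 0 ≤ Real.log (4 / ε) := Real.log_nonneg (by rw [le_div_iff₀ hε0]; linarith)
  have hlog10 : 0 ≤ Real.log (1 / (δ / (8 * k))) := Real.log_nonneg (by
    rw [le_div_iff₀ (by positivity), one_mul, div_le_iff₀ (by positivity)]
    linarith)
  have hbr : Real.log (1 / (δ / (8 * k))) + 2 + Real.log (4 / ε) ≤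
      (10 * k * (8 * k + 5) + 2) * Λ := by
    have : (8 * (k : ℝ) + 5) * 1 ≤ (8 * k + 5) * (10 * k * Λ) := by gcongr
    linarith
  have hΛδ : 10 * k * Λ ≤ 10 * k * Λ / δ := by
    rw [le_div_iff₀ hδ0]
    nlinarith
  refine (Nat.ceil_lt_add_one (by positivity)).le.trans ?_
  calc _ ≤ 2 * k / (p * ε) * ((10 * k * (8 * k + 5) + 2) * Λ) + 10 * k * Λ / δ := by
        gcongr
        linarith
    _ = _ := by
        rw [mul_comm p ε, ← hδ]
        ring

end StochasticMatching
open StochasticMatching in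
theorem mainTheorem5 (K : ℕ) :
    ∃ C : ℝ, ∀ (V : Type*) [Fintype V] (G : SimpleGraph V) [Fintype G.edgeSet],
      G.IsBipartite →
      ∀ lo hi : G.edgeSet → ℕ, (∀ e, lo e ≤ hi e) → (∀ e, hi e ≤ K) →
      ∀ p ε : ℝ, 0 < p → p ≤ 1 → 0 < ε → ε < 1 →
      ∃ A : PMF (QueryTree G.edgeSet),
        (∀ t ∈ A.support, ∀ c : G.edgeSet → ℕ, (∀ e, lo e ≤ c e ∧ c e ≤ hi e) →
          IsMatching (t.result c) ∧
          ∀ v : V, (t.queryCount {e | v ∈ e.1} c : ℝ) ≤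
            C * (Real.log (1 / (ε * p)) / (ε * p))) ∧
        ∀ D : G.edgeSet → PMF ℕ, Compatible lo hi p D →
          ENNReal.ofReal (1 - ε) ≤ successProb A D (IsApproxMaxMatching (1 - ε)) := by
  classical
  -- The shift keeps the weight bound positive when `K = 0`.
  set k := K + 1 with hk
  have hk1 : 1 ≤ k := Nat.le_add_left _ _
  refine ⟨2 * k * (10 * k * (8 * k + 5) + 2) + 10 * k, ?_⟩
  intro V _ G _ hG lo hi _ hhi p ε hp0 hp1 hε0 hε1
  have hhik : ∀ e, hi e ≤ k := fun e => (hhi e).trans (Nat.le_succ K)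
  obtain ⟨l, r, hlr, hmem⟩ := exists_endpoints hG
  have hgood : ∀ (c : G.edgeSet → ℕ) (M : Finset G.edgeSet), EndpointInjective l r M →
      ¬ IsApproxMaxMatching (1 - ε) c M → ¬ ∀ N : Finset G.edgeSet, EndpointInjective l r N →
        (1 - ε) * ((∑ e ∈ N, c e : ℕ) : ℝ) ≤ ((∑ e ∈ M, c e : ℕ) : ℝ) := fun c M hM hnot hall =>
    hnot ⟨(isMatching_iff hlr hmem M).2 hM, fun N hN => hall N ((isMatching_iff hlr hmem N).1 hN)⟩
  by_cases hcorner : 9 / 10 ≤ p ∧ 1 - 1 / (4 * (k : ℝ)) ≤ ε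
  · refine ⟨PMF.pure (.output (maxMatching l r hi)), ?_, fun D hD => ?_⟩
    · intro t ht c _
      rw [PMF.mem_support_pure_iff] at ht
      subst ht
      refine ⟨(isMatching_iff hlr hmem _).2 (maxMatching_endpointInjective l r hi), fun v => ?_⟩
      rw [QueryTree.queryCount, Nat.cast_zero]
      have : 0 ≤ Real.log (1 / (ε * p)) :=
        Real.log_nonneg (by rw [le_div_iff₀ (by positivity)]; nlinarith)
      positivity
    · refine le_successProb_pure _ D _ hε0.le ((measure_mono fun c hc => ?_).trans
        (weightLaw_no_query_fail_le (l := l) (r := r) hD hhik hk1 hcorner.1 hp1 hcorner.2 hε1))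
      exact hgood c _ (maxMatching_endpointInjective l r hi) hc
  · refine ⟨PMF.pure (matchingRounds l r
      ⌈2 * k / (p * ε) * (Real.log (1 / (ε * p / (8 * k))) + 2 + Real.log (4 / ε))⌉₊ ⟨lo, hi⟩),
      ?_, fun D hD => ?_⟩
    · intro t ht c _
      rw [PMF.mem_support_pure_iff] at ht
      subst ht
      refine ⟨?_, fun v => ?_⟩
      · rw [matchingRounds_result]
        exact (isMatching_iff hlr hmem _).2 (maxMatching_endpointInjective l r _)
      · refine le_trans ?_ (rounds_le hk1 hp0 hp1 hε0 hε1 hcorner)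
        refine Nat.cast_le.2 (matchingRounds_queryCount_le l r _
          (fun M hM e he f hf => (isMatching_iff hlr hmem M).2 hM v e he f hf) c _ _)
    · refine le_successProb_pure _ D _ hε0.le ((measure_mono fun c hc => ?_).trans
        (weightLaw_rounds_fail_le hlr hD hhik hk1 hp0 hp1 hε0 hε1 (Nat.le_ceil _)))
      rw [Set.mem_ofPred_eq, matchingRounds_result] at hc
      exact hgood c _ (maxMatching_endpointInjective l r _) hc
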